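/- Let $K$ be a field, $x=(x_1,\dots,x_n)$ an $n$-tuple of variables, and let $p,q\in K[x]$ with $q\neq 0$. Let $R$ be a $K$-subalgebra of the subfield $K(p/q)$ of $K(x)$ which is integrally closed in $K(p/q)$ (i.e. every element of $K(p/q)$ that is integral over $R$ lies in $R$), and assume that $R\neq K$ unless $p/q\in K$. Suppose that $K$ is algebraically closed or that $R$ contains a nonconstant polynomial (an element of $K[x]\setminus K$). Then there exist $p^*,q^*\in K[x]$ with $q^*\neq 0$ such that $$K(p^*/q^*)=K(p/q)\qquad\text{and}\qquad p^*/q^*\in R,$$ where moreover $q^*=1$ can be taken if $R$ contains a nonconstant polynomial. -/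

import Mathlib

/-- The field `K(x) = K(x₁, …, xₙ)` of rational functions in `n` variables over `K`. -/
abbrev RationalFunctionField (n : ℕ) (K : Type*) [Field K] : Type _ :=
  FractionRing (MvPolynomial (Fin n) K)

/-- The element `p / q` of `K(x)`, for polynomials `p, q ∈ K[x]` (only used with `q ≠ 0`). -/
noncomputable abbrev polyFrac {n : ℕ} {K : Type*} [Field K] (p q : MvPolynomial (Fin n) K) :
    RationalFunctionField n K :=
  algebraMap (MvPolynomial (Fin n) K) (RationalFunctionField n K) p /
    algebraMap (MvPolynomial (Fin n) K) (RationalFunctionField n K) q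

/-- The subfield `K(p/q)` of `K(x)` generated by `K` and `p / q`. -/
noncomputable abbrev adjoinFrac {n : ℕ} {K : Type*} [Field K] (p q : MvPolynomial (Fin n) K) :
    IntermediateField K (RationalFunctionField n K) :=
  IntermediateField.adjoin K {polyFrac p q}

/-- A `K`-subalgebra `S` of `K(x)` contains a polynomial `r ∈ K[x]` with `r ∉ K`. -/
def ContainsNonconstantPoly {n : ℕ} {K : Type*} [Field K] (S : Subalgebra K (RationalFunctionField n K)) :
    Prop :=
  ∃ r : MvPolynomial (Fin n) K, r ∉ Set.range (MvPolynomial.C : K → MvPolynomial (Fin n) K) ∧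
    algebraMap (MvPolynomial (Fin n) K) (RationalFunctionField n K) r ∈ S

/-! Let `f = p/q` be nonconstant and write a nonconstant `r ∈ R` as `a(f)/b(f)` with `a, b` coprime.
If `b` is constant, `f` is integral over `K[r]`; if `b` has a root `α ∈ K`, then `1/(f - α)` is.
Either one generates `K(f)`, and it lies in `R` by integral closedness. If `r` is a polynomial, the
generator is also integral over `K[x]`, hence a polynomial. A root is immediate for `K`
algebraically closed. If instead `r` is a polynomial and `p, q` are coprime, the homogenization of
`b` at `(p, q)` is a unit of `K[x]`. For a root `α` of `b` in the algebraic closure, `p - αq`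
divides this unit, so it is constant, and this forces `α ∈ K`. -/

open Polynomial IntermediateField

/-! ### Integral generators of `K(f)` -/

/-- A root of a polynomial whose leading coefficient is a unit is integral. -/
lemma isIntegral_of_isUnit_leadingCoeff {A E : Type*} [CommRing A] [CommRing E] [Algebra A E]
    {x : E} {Q : A[X]} (hQ : IsUnit Q.leadingCoeff) (hx : aeval x Q = 0) : IsIntegral A x := by
  obtain ⟨u, hu⟩ := hQ
  refine ⟨C (↑u⁻¹ : A) * Q, ?_, ?_⟩
  · refine monic_C_mul_of_mul_leadingCoeff_eq_one ?_
    rw [← hu, Units.inv_mul]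
  · rw [← aeval_def, map_mul, hx, mul_zero]

/-- If `a(f) = r b(f)` with `b` constant and `a` nonconstant, then `f` is integral over any
`K`-algebra containing `r`. -/
lemma isIntegral_of_denom_const {K A E : Type*} [Field K] [CommRing A] [Field E] [Algebra K A]
    [Algebra K E] [Algebra A E] [IsScalarTower K A E] {f : E} {r : A} {a b : K[X]}
    (hab : algebraMap A E r * aeval f b = aeval f a) (hb : b.natDegree = 0)
    (ha : a.natDegree ≠ 0) : IsIntegral A f := by
  have : Nontrivial A := (algebraMap A E).domain_nontrivial
  obtain ⟨c, rfl⟩ := natDegree_eq_zero.1 hb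
  have hdeg : (C (r * algebraMap K A c)).degree < (a.map (algebraMap K A)).degree := by
    rw [degree_map]
    exact degree_C_le.trans_lt (natDegree_pos_iff_degree_pos.1 (Nat.pos_of_ne_zero ha))
  refine isIntegral_of_isUnit_leadingCoeff
    (Q := a.map (algebraMap K A) - C (r * algebraMap K A c)) ?_ ?_
  · rw [leadingCoeff_sub_of_degree_lt hdeg, leadingCoeff_map]
    refine IsUnit.map _ (isUnit_iff_ne_zero.2 ?_)
    rintro h
    simp [leadingCoeff_eq_zero.1 h] at ha
  · simp [← hab, ← IsScalarTower.algebraMap_apply]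

/-- If `a(f) = r b(f)` with `b(α) = 0` and `a(α) ≠ 0`, then `1 / (f - α)` is integral over any
`K`-algebra containing `r`. -/
lemma isIntegral_inv_sub_of_isRoot {K A E : Type*} [Field K] [CommRing A] [Field E] [Algebra K A]
    [Algebra K E] [Algebra A E] [IsScalarTower K A E] {f : E} {r : A} {a b : K[X]}
    (hab : algebraMap A E r * aeval f b = aeval f a) {α : K} (hb : b.IsRoot α)
    (ha : ¬ a.IsRoot α) (hf : f ≠ algebraMap K E α) :
    IsIntegral A (f - algebraMap K E α)⁻¹ := by
  have : Nontrivial A := (algebraMap A E).domain_nontrivial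
  set y := f - algebraMap K E α with hy
  have hy0 : y ≠ 0 := sub_ne_zero.2 hf
  -- `T` is `a - r b` expanded around `α`. Its constant term `a(α)` is a unit and becomes the
  -- leading coefficient on reversal, which replaces the root `y` by `1/y`.
  let T : A[X] := (taylor α a).map (algebraMap K A) - C r * (taylor α b).map (algebraMap K A)
  have hT0 : T.coeff 0 = algebraMap K A (a.eval α) := by
    simp [T, taylor_coeff_zero, aeval_algebraMap_apply, hb.eq_zero]
  have hunit : IsUnit (T.coeff 0) := by
    rw [hT0]
    exact (isUnit_iff_ne_zero.2 ha).map _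
  have hTy : aeval y T = 0 := by
    simp [T, taylor_apply, aeval_comp, hy, hab]
  have := invertibleOfNonzero hy0
  refine isIntegral_of_isUnit_leadingCoeff (Q := T.reverse) ?_ ?_
  · rw [reverse_leadingCoeff, trailingCoeff, natTrailingDegree_eq_zero.2 (Or.inr hunit.ne_zero)]
    exact hunit
  · rw [← invOf_eq_inv]
    exact (eval₂_reverse_eq_zero_iff _ _ _).2 hTy

/-- An element of `K(f)` is a quotient of coprime polynomials in `f`. -/
lemma exists_coprime_of_mem_adjoin_simple {K E : Type*} [Field K] [Field E] [Algebra K E] {f r : E}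
    (hr : r ∈ K⟮f⟯) :
    ∃ a b : K[X], IsCoprime a b ∧ aeval f b ≠ 0 ∧ r * aeval f b = aeval f a := by
  classical
  by_cases h0 : r = 0
  · exact ⟨0, 1, isCoprime_one_right, by simp, by simp [h0]⟩
  obtain ⟨a, b, rfl⟩ := (mem_adjoin_simple_iff K r).1 hr
  have hb : aeval f b ≠ 0 := fun h ↦ h0 (by simp [h])
  have hb0 : b ≠ 0 := by rintro rfl; simp at hb
  have hcop := isCoprime_div_gcd_div_gcd (p := a) hb0
  have ha' := EuclideanDomain.mul_div_cancel' (gcd_ne_zero_of_right hb0) (gcd_dvd_left a b)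
  have hb' := EuclideanDomain.mul_div_cancel' (gcd_ne_zero_of_right hb0) (gcd_dvd_right a b)
  generalize gcd a b = d at *
  generalize a / d = a' at *
  generalize b / d = b' at *
  subst ha' hb'
  simp only [map_mul, mul_ne_zero_iff] at hb
  refine ⟨a', b', hcop, hb.2, ?_⟩
  have := hb.1
  have := hb.2
  simp only [map_mul]
  field_simp

/-- If `a(f) = r b(f)` with `r` nonconstant, and `b` is constant or has a root in `K`, then `K(f)`
has a generator that is integral over every `K`-algebra containing `r`. -/
lemma exists_integral_generator {K E : Type*} [Field K] [Field E] [Algebra K E] {f r : E}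
    (hf : f ∉ Set.range (algebraMap K E)) (hr : r ∉ Set.range (algebraMap K E)) {a b : K[X]}
    (hcop : IsCoprime a b) (hb0 : aeval f b ≠ 0) (hab : r * aeval f b = aeval f a)
    (hb : b.natDegree = 0 ∨ ∃ α, b.IsRoot α) :
    ∃ g : E, K⟮g⟯ = K⟮f⟯ ∧ ∀ (A : Type _) [CommRing A] [Algebra K A] [Algebra A E]
      [IsScalarTower K A E], r ∈ Set.range (algebraMap A E) → IsIntegral A g := by
  rcases hb with hb | ⟨α, hα⟩
  · refine ⟨f, rfl, ?_⟩
    rintro A _ _ _ _ ⟨s, rfl⟩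
    refine isIntegral_of_denom_const hab hb fun ha ↦ hr ?_
    obtain ⟨c, rfl⟩ := natDegree_eq_zero.1 hb
    obtain ⟨d, rfl⟩ := natDegree_eq_zero.1 ha
    simp only [aeval_C] at hab hb0
    exact ⟨d / c, by rw [map_div₀, ← hab, mul_div_cancel_right₀ _ hb0]⟩
  · refine ⟨(f - algebraMap K E α)⁻¹, ?_, ?_⟩
    · apply le_antisymm <;> rw [adjoin_simple_le_iff]
      · exact inv_mem (sub_mem (mem_adjoin_simple_self K f) (IntermediateField.algebraMap_mem _ α))
      · have h := inv_mem (mem_adjoin_simple_self K (f - algebraMap K E α)⁻¹)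
        rw [inv_inv] at h
        simpa using add_mem h (IntermediateField.algebraMap_mem K⟮(f - algebraMap K E α)⁻¹⟯ α)
    · rintro A _ _ _ _ ⟨s, rfl⟩
      refine isIntegral_inv_sub_of_isRoot hab hα (fun ha ↦ ?_) fun h ↦ hf ⟨α, h.symm⟩
      obtain ⟨u, v, huv⟩ := hcop
      have := congrArg (eval α) huv
      simp [ha.eq_zero, hα.eq_zero] at this

/-! ### Rational roots of the denominator `b` -/

/-- If `p` and `q` are coprime then so are `q` and the homogenization of `b` evaluated
at `(p, q)`. -/
lemma isRelPrime_eval_scaleRoots {K S : Type*} [Field K] [CommRing S] [IsDomain S]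
    [DecompositionMonoid S] [Algebra K S] {p q : S} (hpq : IsRelPrime p q) {b : K[X]} (hb : b ≠ 0) :
    IsRelPrime (((b.map (algebraMap K S)).scaleRoots q).eval p) q := by
  intro d hd hdq
  set B := b.map (algebraMap K S)
  have hdeg : B.natDegree = b.natDegree := natDegree_map _
  have hlc : IsUnit B.leadingCoeff := by
    rw [leadingCoeff_map]
    exact (isUnit_iff_ne_zero.2 (leadingCoeff_ne_zero.2 hb)).map _
  -- All terms but the top one carry a positive power of `q`.
  have hsum : d ∣ B.leadingCoeff * p ^ B.natDegree := by
    rw [eval_eq_sum_range, natDegree_scaleRoots, Finset.sum_range_succ,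
      coeff_scaleRoots_natDegree] at hd
    refine (dvd_add_right (Finset.dvd_sum fun i hi ↦ ?_)).1 hd
    rw [coeff_scaleRoots]
    exact Dvd.dvd.mul_right (Dvd.dvd.mul_left (hdq.trans (dvd_pow_self _
      (Nat.sub_ne_zero_of_lt (Finset.mem_range.1 hi)))) _) _
  rw [hlc.dvd_mul_left] at hsum
  exact (hpq.pow_left (m := B.natDegree)) hsum hdq

/-- If a polynomial `r` equals `a(p/q) / b(p/q)` with `a, b` coprime and `p, q` coprime, then the
homogenization of `b` evaluated at `(p, q)` is a unit. -/
lemma isUnit_eval_scaleRoots {K S E : Type*} [Field K] [CommRing S] [IsDomain S]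
    [DecompositionMonoid S] [Algebra K S] [Field E] [Algebra K E] [Algebra S E]
    [IsScalarTower K S E] [FaithfulSMul S E] {p q r : S} (hq : q ≠ 0) (hpq : IsRelPrime p q)
    {a b : K[X]} (hcop : IsCoprime a b) (hb : b ≠ 0)
    (hab : algebraMap S E r * aeval (algebraMap S E p / algebraMap S E q) b =
      aeval (algebraMap S E p / algebraMap S E q) a) :
    IsUnit (((b.map (algebraMap K S)).scaleRoots q).eval p) := by
  have hq0 : algebraMap S E q ≠ 0 := by simpa using hq
  have hom (c : K[X]) : algebraMap S E (((c.map (algebraMap K S)).scaleRoots q).eval p) =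
      algebraMap S E q ^ c.natDegree * aeval (algebraMap S E p / algebraMap S E q) c := by
    have h := scaleRoots_eval₂_mul (p := c.map (algebraMap K S)) (algebraMap S E)
      (algebraMap S E p / algebraMap S E q) q
    rw [mul_div_cancel₀ _ hq0, eval₂_at_apply, natDegree_map, eval₂_map,
      ← IsScalarTower.algebraMap_eq] at h
    exact h
  obtain ⟨u, v, huv⟩ := hcop
  have huv' := congrArg (aeval (algebraMap S E p / algebraMap S E q)) huv
  simp only [map_add, map_mul, map_one, ← hab] at huv'
  -- Clearing denominators in `u(f) r b(f) + v(f) b(f) = 1` shows that the homogenization of `b`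
  -- divides this power of `q`, to which it is coprime.
  refine (isRelPrime_eval_scaleRoots hpq hb).pow_right
    (n := b.natDegree + u.natDegree + v.natDegree) |>.isUnit_of_dvd ?_
  refine ⟨((u.map (algebraMap K S)).scaleRoots q).eval p * r * q ^ v.natDegree +
    ((v.map (algebraMap K S)).scaleRoots q).eval p * q ^ u.natDegree, ?_⟩
  apply FaithfulSMul.algebraMap_injective S E
  simp only [map_mul, map_add, map_pow, hom]
  linear_combination (-(algebraMap S E q ^ (b.natDegree + u.natDegree + v.natDegree))) * huv'

/-- If `p - α q` is a constant for some `α` in an extension field of `K`, then `α ∈ K` or both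
`p` and `q` are constants. -/
lemma mem_range_or_eq_C_of_sub_eq_C {K F σ : Type*} [Field K] [Field F] [Algebra K F]
    {p q : MvPolynomial σ K} {α c : F}
    (h : MvPolynomial.map (algebraMap K F) p - MvPolynomial.map (algebraMap K F) q *
      MvPolynomial.C α = MvPolynomial.C c) :
    α ∈ Set.range (algebraMap K F) ∨
      (∃ x, p = MvPolynomial.C x) ∧ ∃ y, q = MvPolynomial.C y := by
  classical
  by_contra! hcon
  obtain ⟨hα, hpq⟩ := hcon
  -- At `m ≠ 0` the coefficients satisfy `p_m = α q_m`, so `q_m ≠ 0` would put `α` in `K`.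
  have key (m : σ →₀ ℕ) (hm : m ≠ 0) : p.coeff m = 0 ∧ q.coeff m = 0 := by
    have h1 := congrArg (MvPolynomial.coeff m) h
    rw [MvPolynomial.coeff_sub, mul_comm, MvPolynomial.coeff_C_mul, MvPolynomial.coeff_map,
      MvPolynomial.coeff_map, MvPolynomial.coeff_C, if_neg hm.symm, sub_eq_zero] at h1
    have hqm : q.coeff m = 0 := by
      by_contra hqm
      have : algebraMap K F (q.coeff m) ≠ 0 := by simpa using hqm
      exact hα ⟨p.coeff m / q.coeff m, by rw [map_div₀, h1, mul_div_cancel_right₀ _ this]⟩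
    exact ⟨by simpa [hqm] using h1, hqm⟩
  have hC (s : MvPolynomial σ K) (hs : ∀ m ≠ 0, s.coeff m = 0) :
      s = MvPolynomial.C (s.coeff 0) := by
    ext m
    rw [MvPolynomial.coeff_C]
    split_ifs with hm
    · rw [hm]
    · exact hs m (Ne.symm hm)
  exact hpq ⟨_, hC p fun m hm ↦ (key m hm).1⟩ _ (hC q fun m hm ↦ (key m hm).2)

/-- If a polynomial is equal to `a(p/q) / b(p/q)` with `a, b` coprime and `p/q` nonconstant, then
`b` is constant or has a root in the ground field. -/
lemma natDegree_eq_zero_or_exists_isRoot {K σ : Type*} [Field K] {p q r : MvPolynomial σ K}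
    (hq : q ≠ 0) (hpq : IsRelPrime p q)
    (hconst : ¬ ((∃ x, p = MvPolynomial.C x) ∧ ∃ y, q = MvPolynomial.C y))
    {a b : K[X]} (hcop : IsCoprime a b) (hb : b ≠ 0)
    (hab : algebraMap _ (FractionRing (MvPolynomial σ K)) r *
        aeval (algebraMap _ (FractionRing (MvPolynomial σ K)) p / algebraMap _ _ q) b =
      aeval (algebraMap _ (FractionRing (MvPolynomial σ K)) p / algebraMap _ _ q) a) :
    b.natDegree = 0 ∨ ∃ α, b.IsRoot α := by
  refine or_iff_not_imp_left.2 fun hdeg ↦ ?_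
  let F := AlgebraicClosure K
  let φ : MvPolynomial σ K →+* MvPolynomial σ F := MvPolynomial.map (algebraMap K F)
  obtain ⟨α, hα⟩ := IsAlgClosed.exists_aeval_eq_zero F b
    fun h ↦ hdeg (natDegree_eq_of_degree_eq_some h)
  have hu := (isUnit_eval_scaleRoots hq hpq hcop hb hab).map φ
  set B := b.map (algebraMap K (MvPolynomial σ K)) with hB
  have hroot : eval₂ φ (φ q * MvPolynomial.C α) (B.scaleRoots q) = 0 := by
    refine scaleRoots_eval₂_eq_zero φ ?_
    have : φ.comp (algebraMap K (MvPolynomial σ K)) =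
        (MvPolynomial.C : F →+* MvPolynomial σ F).comp (algebraMap K F) := by
      ext x : 1
      simp [φ, MvPolynomial.algebraMap_eq]
    rw [hB, eval₂_map, this, ← hom_eval₂, ← aeval_def, hα, map_zero]
  have hdvd := sub_dvd_eval_sub (φ p) (φ q * MvPolynomial.C α) ((B.scaleRoots q).map φ)
  rw [eval_map, eval_map, hroot, sub_zero, eval₂_at_apply] at hdvd
  obtain ⟨c, -, hc⟩ := MvPolynomial.isUnit_iff_eq_C_of_isReduced.1 (isUnit_of_dvd_unit hdvd hu)
  obtain ⟨β, rfl⟩ := (mem_range_or_eq_C_of_sub_eq_C hc).resolve_right hconst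
  refine ⟨β, ?_⟩
  rw [aeval_algebraMap_apply] at hα
  simpa using hα

theorem mainTheorem9 {K : Type*} [Field K] {n : ℕ}
    (p q : MvPolynomial (Fin n) K) (hq : q ≠ 0)
    (R : Subalgebra K (adjoinFrac p q))
    (hR : IsIntegrallyClosedIn R (adjoinFrac p q))
    (hne : R = ⊥ → polyFrac p q ∈ Set.range (algebraMap K (RationalFunctionField n K)))
    (h : IsAlgClosed K ∨ ContainsNonconstantPoly (R.map (adjoinFrac p q).val)) :
    ∃ p' q' : MvPolynomial (Fin n) K, q' ≠ 0 ∧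
      adjoinFrac p' q' = adjoinFrac p q ∧
      polyFrac p' q' ∈ R.map (adjoinFrac p q).val ∧
      (ContainsNonconstantPoly (R.map (adjoinFrac p q).val) → q' = 1) := by
  by_cases hf : polyFrac p q ∈ Set.range (algebraMap K (RationalFunctionField n K))
  · obtain ⟨c, hc⟩ := hf
    have hc' : polyFrac (MvPolynomial.C c : MvPolynomial (Fin n) K) 1 = polyFrac p q := by
      rw [← hc, polyFrac, map_one, div_one, IsScalarTower.algebraMap_apply K
        (MvPolynomial (Fin n) K), MvPolynomial.algebraMap_eq]
    refine ⟨MvPolynomial.C c, 1, one_ne_zero, ?_, ?_, fun _ ↦ rfl⟩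
    · rw [adjoinFrac, hc']
    · rw [hc', ← hc]
      exact Subalgebra.algebraMap_mem _ c
  have hconst {s : MvPolynomial (Fin n) K}
      (hs : s ∉ Set.range (MvPolynomial.C : K → MvPolynomial (Fin n) K)) :
      algebraMap _ (RationalFunctionField n K) s ∉
        Set.range (algebraMap K (RationalFunctionField n K)) := by
    rintro ⟨c, hc⟩
    rw [IsScalarTower.algebraMap_apply K (MvPolynomial (Fin n) K)] at hc
    exact hs ⟨c, IsFractionRing.injective _ _ hc⟩
  -- A polynomial is chosen whenever possible, so that a single generator serves both `R` and
  -- `K[x]`.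
  obtain ⟨r, hrR, hrK, hrpoly⟩ : ∃ r : RationalFunctionField n K,
      r ∈ R.map (adjoinFrac p q).val ∧ r ∉ Set.range (algebraMap K (RationalFunctionField n K)) ∧
      (ContainsNonconstantPoly (R.map (adjoinFrac p q).val) →
        r ∈ Set.range (algebraMap (MvPolynomial (Fin n) K) (RationalFunctionField n K))) := by
    by_cases hpoly : ContainsNonconstantPoly (R.map (adjoinFrac p q).val)
    · obtain ⟨s, hs, hsR⟩ := hpoly
      exact ⟨_, hsR, hconst hs, fun _ ↦ ⟨s, rfl⟩⟩
    · obtain ⟨x, hxR, hx⟩ : ∃ x ∈ R, x ∉ (⊥ : Subalgebra K (adjoinFrac p q)) := by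
        by_contra! hcon
        exact hf (hne (le_bot_iff.1 hcon))
      refine ⟨x, ⟨x, hxR, rfl⟩, ?_, fun h ↦ absurd h hpoly⟩
      rintro ⟨c, hc⟩
      exact hx (Algebra.mem_bot.2 ⟨c, Subtype.ext hc⟩)
  obtain ⟨⟨r, hrL⟩, hrR, rfl⟩ := hrR
  obtain ⟨a, b, hcop, hb0, hab⟩ := exists_coprime_of_mem_adjoin_simple hrL
  have hroot : b.natDegree = 0 ∨ ∃ α, b.IsRoot α := by
    rcases h with h | h
    · refine or_iff_not_imp_left.2 fun hdeg ↦ IsAlgClosed.exists_root b fun h ↦ hdeg ?_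
      exact natDegree_eq_of_degree_eq_some h
    · obtain ⟨s, hs⟩ := hrpoly h
      -- The given `p, q` need not be coprime.
      obtain ⟨p₀, q₀, hrel, hpq₀⟩ :=
        IsFractionRing.exists_reduced_fraction (MvPolynomial (Fin n) K) (polyFrac p q)
      rw [IsFractionRing.mk'_eq_div] at hpq₀
      refine natDegree_eq_zero_or_exists_isRoot (r := s) (nonZeroDivisors.coe_ne_zero q₀) hrel ?_
        hcop (by rintro rfl; simp at hb0) ?_
      · rintro ⟨⟨x, hx⟩, y, hy⟩
        refine hf ⟨x / y, ?_⟩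
        rw [← hpq₀, hx, hy, map_div₀, ← MvPolynomial.algebraMap_eq,
          ← IsScalarTower.algebraMap_apply, ← IsScalarTower.algebraMap_apply]
      · rw [hpq₀, hs]
        exact hab
  obtain ⟨g, hg, hint⟩ := exists_integral_generator hf hrK hcop hb0 hab hroot
  have hgL : g ∈ adjoinFrac p q := hg.le (mem_adjoin_simple_self K g)
  have hgR : g ∈ R.map (adjoinFrac p q).val := by
    have h1 : IsIntegral R (algebraMap (adjoinFrac p q) (RationalFunctionField n K) ⟨g, hgL⟩) :=
      hint R ⟨⟨⟨r, hrL⟩, hrR⟩, rfl⟩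
    rw [isIntegral_algebraMap_iff (algebraMap (adjoinFrac p q) _).injective] at h1
    obtain ⟨y, hy⟩ := IsIntegrallyClosedIn.isIntegral_iff.1 h1
    exact ⟨y, y.2, congrArg Subtype.val hy⟩
  by_cases hpoly : ContainsNonconstantPoly (R.map (adjoinFrac p q).val)
  · obtain ⟨s, rfl⟩ := IsIntegrallyClosed.isIntegral_iff.1
      (hint (MvPolynomial (Fin n) K) (hrpoly hpoly))
    have hs : polyFrac s 1 = algebraMap _ (RationalFunctionField n K) s := by simp [polyFrac]
    refine ⟨s, 1, one_ne_zero, ?_, ?_, fun _ ↦ rfl⟩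
    · rw [adjoinFrac, hs, hg]
    · rwa [hs]
  · obtain ⟨p', q', hq', rfl⟩ := IsFractionRing.div_surjective (A := MvPolynomial (Fin n) K) g
    exact ⟨p', q', nonZeroDivisors.ne_zero hq', hg, hgR, fun h ↦ absurd h hpoly⟩
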